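/- Let $K$ be a field, let $S=K[x_1,\dots,x_n]$, and let $M\subseteq S$ be a monomial ideal with minimal set of monomial generators $G$. A monomial $m\in G$ is called *dominant* (in $G$) if there are a variable $x$ and an integer $k>0$ such that $x^k\mid m$ and $x^k\nmid m'$ for all $m'\in G\setminus\{m\}$. The ideal $M$ is *semidominant* (or 1-semidominant) if exactly one element of $G$ is not dominant. The *Scarf complex* of $M$ is the simplicial complex of all subsets $\sigma\subseteq G$ such that $\operatorname{lcm}(\sigma)\ne\operatorname{lcm}(\tau)$ for every $\tau\subseteq G$ with $\tau\neq\sigma$ (here $\operatorname{lcm}(\varnothing)=1$). The *algebraic Scarf complex* of $M$ has as its component in homological degree $i$ the free $S$-module with basis the symbols $[\sigma]$, for $\sigma$ in the Scarf complex with $|\sigma|=i$; for a fixed ordering of $G$ its differential is $$[l_{1},\dots,l_{i}]\longmapsto\sum_{j=1}^{i}(-1)^{j+1}\,\frac{\operatorname{lcm}(l_1,\dots,l_i)}{\operatorname{lcm}(l_1,\dots,\widehat{l_j},\dots,l_i)}\,[l_1,\dots,\widehat{l_j},\dots,l_i],$$ and it is augmented to $S/M$ by $[\varnothing]\mapsto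 1$. The ideal $M$ is *Scarf* if its algebraic Scarf complex (for any ordering of $G$) is a minimal free resolution of $S/M$. Here minimal means that the image of each differential is contained in $(x_1,\dots,x_n)$ times its target. Corollary 5.9. Every semidominant ideal is Scarf. Moreover, every monomial almost complete intersection is Scarf, that is, every monomial ideal whose minimal set of monomial generators has the form $\{l_1,\dots,l_q,l\}$, where $l_1,\dots,l_q$ is a regular sequence in $S$. -/

import Mathlib

/-! Throughout, a monomial of `MvPolynomial σ K` is identified with its exponent vector
`a : σ →₀ ℕ`; divisibility of monomials is `a ≤ b`, and the lcm is the supremum. -/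

noncomputable section

/-! ### Monomial ideals and their minimal generating sets -/

/-- An ideal generated by monomials. -/
def IsMonomialIdeal {σ K : Type*} [Field K] (M : Ideal (MvPolynomial σ K)) : Prop :=
  ∃ A : Set (σ →₀ ℕ), M = Ideal.span ((fun a => MvPolynomial.monomial a (1 : K)) '' A)

/-- The minimal generating set of a monomial ideal: the monomials of `M` that are minimal with
respect to divisibility. -/
def minGens {σ K : Type*} [Field K] (M : Ideal (MvPolynomial σ K)) : Set (σ →₀ ℕ) :=
  {a | Minimal (fun b : σ →₀ ℕ => MvPolynomial.monomial b (1 : K) ∈ M) a}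

/-- The minimal monomials do generate a monomial ideal. -/
theorem IsMonomialIdeal.span_minGens {σ K : Type*} [Field K]
    {M : Ideal (MvPolynomial σ K)} (hM : IsMonomialIdeal M) :
    Ideal.span ((fun a => MvPolynomial.monomial a (1 : K)) '' minGens M) = M := by
  apply le_antisymm
  · rw [Ideal.span_le]
    rintro _ ⟨a, ha, rfl⟩
    exact Minimal.prop (P := fun b : σ →₀ ℕ => MvPolynomial.monomial b (1 : K) ∈ M) ha
  · obtain ⟨A, hA⟩ := hM
    conv_lhs => rw [hA]
    rw [Ideal.span_le]
    rintro _ ⟨a, ha, rfl⟩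
    have haM : MvPolynomial.monomial a (1 : K) ∈ M := by
      rw [hA]
      exact Ideal.subset_span ⟨a, ha, rfl⟩
    obtain ⟨b, hba, hb⟩ := exists_minimal_le_of_wellFoundedLT
      (fun b : σ →₀ ℕ => MvPolynomial.monomial b (1 : K) ∈ M) a haM
    have h : MvPolynomial.monomial a (1 : K)
        = MvPolynomial.monomial (a - b) 1 * MvPolynomial.monomial b 1 := by
      rw [MvPolynomial.monomial_mul, tsub_add_cancel_of_le hba, one_mul]
    change MvPolynomial.monomial a (1 : K) ∈ _
    rw [h]
    exact Ideal.mul_mem_left _ _ (Ideal.subset_span ⟨b, hb, rfl⟩)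

/-- In finitely many variables the minimal generators can be listed as `m 0, …, m (r - 1)`
without repetition. -/
theorem exists_enum_minGens {σ K : Type*} [Finite σ] [Field K] (M : Ideal (MvPolynomial σ K)) :
    ∃ (r : ℕ) (m : Fin r → (σ →₀ ℕ)), Function.Injective m ∧ Set.range m = minGens M := by
  have hfin : (minGens M).Finite :=
    WellQuasiOrderedLE.finite_of_isAntichain (setOfPred_minimal_antichain _)
  obtain ⟨r, m, hm, hr⟩ := hfin.fin_param
  exact ⟨r, m, hm, hr⟩

/-! ### Dominance -/

/-- `a ∈ G` is a dominant monomial of `G`: it has a dominant variable `x`, i.e. for some `k > 0`,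
`x ^ k` divides `a` and divides no other element of `G`. -/
def IsDominantIn {σ : Type*} (G : Set (σ →₀ ℕ)) (a : σ →₀ ℕ) : Prop :=
  ∃ x : σ, ∃ k : ℕ, 0 < k ∧ k ≤ a x ∧ ∀ b ∈ G, b ≠ a → ¬ k ≤ b x

/-- Exactly one element of `G` is not dominant. -/
def IsSemidominantSet {σ : Type*} (G : Set (σ →₀ ℕ)) : Prop :=
  ∃! n : σ →₀ ℕ, n ∈ G ∧ ¬ IsDominantIn G n

/-- A semidominant (1-semidominant) ideal: a monomial ideal whose minimal generating set is
semidominant. -/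
def IsSemidominantIdeal {σ K : Type*} [Field K] (M : Ideal (MvPolynomial σ K)) : Prop :=
  IsMonomialIdeal M ∧ IsSemidominantSet (minGens M)

/-- A monomial almost complete intersection: a monomial ideal minimally generated by monomials
`l₁, …, l_q, l` such that `l₁, …, l_q` is a regular sequence. -/
def IsMonomialAlmostCI {σ K : Type*} [Field K] (M : Ideal (MvPolynomial σ K)) : Prop :=
  IsMonomialIdeal M ∧
    ∃ (L : List (σ →₀ ℕ)) (l : σ →₀ ℕ), l ∉ L ∧ minGens M = insert l {a | a ∈ L} ∧
      RingTheory.Sequence.IsRegular (MvPolynomial σ K)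
        (L.map fun a => MvPolynomial.monomial a (1 : K))

/-! ### Minimal free resolutions -/

/-- `⋯ → F 2 → F 1 → F 0 → S ⧸ I → 0`, with differentials `d i : F (i + 1) → F i` and augmentation
`ε`, is a minimal free resolution of `S ⧸ I`: the `F i` are free of finite rank, the sequence is
exact, and the image of each differential lies in `𝔪 • F i`, where `𝔪` is the ideal generated by
the variables of `S`. -/
structure IsMinimalFreeResolution {σ K : Type*} [Field K] (I : Ideal (MvPolynomial σ K))
    (F : ℕ → Type*) [∀ i, AddCommGroup (F i)] [∀ i, Module (MvPolynomial σ K) (F i)]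
    (d : ∀ i, F (i + 1) →ₗ[MvPolynomial σ K] F i)
    (ε : F 0 →ₗ[MvPolynomial σ K] (MvPolynomial σ K ⧸ I)) : Prop where
  free : ∀ i, Module.Free (MvPolynomial σ K) (F i)
  finite : ∀ i, Module.Finite (MvPolynomial σ K) (F i)
  exact_succ : ∀ i, Function.Exact (d (i + 1)) (d i)
  exact_zero : Function.Exact (d 0) ε
  surjective : Function.Surjective ε
  minimal : ∀ i, LinearMap.range (d i) ≤
    Ideal.span (Set.range (MvPolynomial.X : σ → MvPolynomial σ K)) •
      (⊤ : Submodule (MvPolynomial σ K) (F i))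

/-! ### The Scarf complex -/

/-- The multidegree of a face: the lcm of the monomials labelling its vertices. -/
def mdeg {σ : Type*} {r : ℕ} (m : Fin r → (σ →₀ ℕ)) (s : Finset (Fin r)) : σ →₀ ℕ :=
  s.sup m

/-- `s` is a face of the Scarf complex: no other face of the full simplex on the generators
(the empty face included) has the same multidegree. -/
def IsScarfFace {σ : Type*} {r : ℕ} (m : Fin r → (σ →₀ ℕ)) (s : Finset (Fin r)) : Prop :=
  ∀ t : Finset (Fin r), mdeg m t = mdeg m s → t = s

/-- The Scarf complex is a simplicial complex: facets of faces are faces. -/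
theorem IsScarfFace.erase {σ : Type*} {r : ℕ} {m : Fin r → (σ →₀ ℕ)} {s : Finset (Fin r)}
    (hs : IsScarfFace m s) {j : Fin r} (hj : j ∈ s) : IsScarfFace m (s.erase j) := by
  intro t ht
  have h1 : insert j t = s := by
    apply hs
    unfold mdeg at ht ⊢
    rw [Finset.sup_insert, ht, ← Finset.sup_insert, Finset.insert_erase hj]
  by_cases hjt : j ∈ t
  · exfalso
    rw [Finset.insert_eq_of_mem hjt] at h1
    subst h1
    exact absurd (hs _ ht.symm) (Finset.erase_ne_self.2 hj)
  · rw [← h1, Finset.erase_insert hjt]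

/-- The faces of the Scarf complex with `i` vertices: the basis of the algebraic Scarf complex in
homological degree `i`. -/
abbrev ScarfFace {σ : Type*} {r : ℕ} (m : Fin r → (σ →₀ ℕ)) (i : ℕ) : Type :=
  {s : Finset (Fin r) // IsScarfFace m s ∧ s.card = i}

/-- The facet of a Scarf face obtained by deleting the vertex `j`. -/
def ScarfFace.del {σ : Type*} {r : ℕ} {m : Fin r → (σ →₀ ℕ)} {i : ℕ}
    (s : ScarfFace m (i + 1)) (j : Fin r) (hj : j ∈ s.1) : ScarfFace m i :=
  ⟨s.1.erase j, s.2.1.erase hj, by rw [Finset.card_erase_of_mem hj, s.2.2]; rfl⟩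

/-- The differential of the Taylor resolution restricted to the Scarf complex:
`d [s] = ∑ⱼ (-1)^(position of j in s) (mdeg s / mdeg (s \ {j})) [s \ {j}]`. -/
def scarfD {σ : Type*} (K : Type*) [Field K] {r : ℕ} (m : Fin r → (σ →₀ ℕ)) (i : ℕ) :
    (ScarfFace m (i + 1) →₀ MvPolynomial σ K) →ₗ[MvPolynomial σ K]
      (ScarfFace m i →₀ MvPolynomial σ K) :=
  Finsupp.linearCombination (MvPolynomial σ K) fun s : ScarfFace m (i + 1) =>
    ∑ j : {j : Fin r // j ∈ s.1},
      Finsupp.single (s.del j.1 j.2)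
        (MvPolynomial.monomial (mdeg m s.1 - mdeg m (s.1.erase j.1))
          ((-1 : K) ^ (s.1.filter (· < j.1)).card))

/-- The augmentation `F 0 → S ⧸ M`, `[∅] ↦ 1`. -/
def scarfAug {σ K : Type*} [Field K] (M : Ideal (MvPolynomial σ K)) {r : ℕ}
    (m : Fin r → (σ →₀ ℕ)) :
    (ScarfFace m 0 →₀ MvPolynomial σ K) →ₗ[MvPolynomial σ K] (MvPolynomial σ K ⧸ M) :=
  Finsupp.linearCombination (MvPolynomial σ K) fun _ : ScarfFace m 0 => 1

/-- `M` is Scarf: for every listing `m` of its minimal generators, the algebraic Scarf complex is a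
minimal free resolution of `S ⧸ M`. -/
def IsScarfIdeal {σ K : Type*} [Field K] (M : Ideal (MvPolynomial σ K)) : Prop :=
  ∀ (r : ℕ) (m : Fin r → (σ →₀ ℕ)), Function.Injective m → Set.range m = minGens M →
    IsMinimalFreeResolution M (fun i => ScarfFace m i →₀ MvPolynomial σ K)
      (scarfD K m) (scarfAug M m)

end

/-! The algebraic Scarf complex is multigraded: over `K`, its strand in degree `b` is the chain
complex of the Scarf faces whose lcm divides `x ^ b`. If these faces form a cone for every `b` with
`x ^ b ∈ M`, then coning with the apex is a contracting homotopy (`scarf_homotopy`), and the complex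
resolves `S ⧸ M`. Minimality is automatic: deleting a vertex of a Scarf face strictly lowers its
lcm. Cones exist when at most one generator `m n` is not dominant. An lcm determines which dominant
generators occur in it, so distinct faces with the same lcm differ only in `n`. Hence `n` is an apex
if `m n ≤ b`, and any generator dividing `x ^ b` is one otherwise (`exists_isScarfApex`). In an
almost complete intersection the `l_i` are pairwise coprime and do not divide `l`, which makes each
of them dominant. -/

/-- If all generators but `m n` are dominant, then two faces of the same multidegree have the same
vertices apart from `n`. -/
theorem mem_iff_mem_of_mdeg_eq {σ : Type*} {r : ℕ} {m : Fin r → (σ →₀ ℕ)}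
    (hm : Function.Injective m) {i : Fin r} (hi : IsDominantIn (Set.range m) (m i))
    {s t : Finset (Fin r)} (h : mdeg m t = mdeg m s) : i ∈ t ↔ i ∈ s := by
  obtain ⟨x, k, hk, hle, hlt⟩ := hi
  have key : ∀ u : Finset (Fin r), i ∈ u ↔ k ≤ mdeg m u x := by
    intro u
    constructor
    · intro hu
      exact hle.trans (Finset.le_sup (f := m) hu x)
    · contrapose!
      intro hu
      unfold mdeg
      -- Positivity of `k` covers the empty face, whose exponent at `x` is 0.
      refine Finset.sup_induction (p := fun a : σ →₀ ℕ => a x < k) hk ?_ ?_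
      · intro a ha b hb
        simpa using ⟨ha, hb⟩
      · intro j hj
        refine not_le.1 (hlt _ ⟨j, rfl⟩ ?_)
        intro e
        exact hu (hm e ▸ hj)
  rw [key, key, h]

/-- `v` is an apex in degree `b`: the faces of the Scarf complex of degree at most `b` form a cone
over the vertex `v`. -/
def IsScarfApex {σ : Type*} {r : ℕ} (m : Fin r → (σ →₀ ℕ)) (b : σ →₀ ℕ) (v : Fin r) : Prop :=
  m v ≤ b ∧ ∀ s, IsScarfFace m s → mdeg m s ≤ b → IsScarfFace m (insert v s)

/-- If `m n ≤ b`, the only possible rival of `insert n s` is `s`, and equal lcms would contradict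
that `s` is Scarf. If not, no face of degree at most `b` contains `n`, so each such face is
determined by its lcm. -/
theorem exists_isScarfApex {σ : Type*} {r : ℕ} {m : Fin r → (σ →₀ ℕ)}
    (hm : Function.Injective m) {n : Fin r}
    (hdom : ∀ i, i ≠ n → IsDominantIn (Set.range m) (m i)) {b : σ →₀ ℕ} {j : Fin r}
    (hj : m j ≤ b) : ∃ v, IsScarfApex m b v := by
  by_cases hn : m n ≤ b
  · refine ⟨n, hn, fun s hs _ => ?_⟩
    by_cases hns : n ∈ s
    · rwa [Finset.insert_eq_of_mem hns]
    intro t ht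
    have hmem : ∀ i, i ≠ n → (i ∈ t ↔ i ∈ insert n s) := fun i hi =>
      mem_iff_mem_of_mdeg_eq hm (hdom i hi) ht
    by_cases hnt : n ∈ t
    · ext i
      by_cases hi : i = n
      · subst hi; simp [hnt]
      · exact hmem i hi
    · have hts : t = s := by
        ext i
        by_cases hi : i = n
        · subst hi; simp [hnt, hns]
        · simpa [hi] using hmem i hi
      subst hts
      exact absurd (hs _ ht.symm) (Finset.insert_ne_self.2 hns)
  · refine ⟨j, hj, fun s hs hsb t ht => ?_⟩
    have hins : mdeg m (insert j s) ≤ b := by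
      unfold mdeg at hsb ⊢
      rw [Finset.sup_insert]
      exact sup_le hj hsb
    have hnot : ∀ u : Finset (Fin r), mdeg m u ≤ b → n ∉ u := fun u hu hnu =>
      hn ((Finset.le_sup (f := m) hnu).trans hu)
    ext i
    by_cases hi : i = n
    · subst hi
      simp only [hnot _ hins, hnot t (ht.le.trans hins)]
    · exact mem_iff_mem_of_mdeg_eq hm (hdom i hi) ht

/-! ### Homogeneous elements, signs and the boundary -/

open Classical in
/-- The element `x ^ (b - mdeg s) [s]` of degree `b` of the algebraic Scarf complex, and `0` if `s`
is not a Scarf face with `i` vertices. -/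
noncomputable def scarfElem {σ : Type*} (K : Type*) [Field K] {r : ℕ} (m : Fin r → (σ →₀ ℕ))
    (i : ℕ) (b : σ →₀ ℕ) (s : Finset (Fin r)) : ScarfFace m i →₀ MvPolynomial σ K :=
  if h : IsScarfFace m s ∧ s.card = i then
    Finsupp.single ⟨s, h⟩ (MvPolynomial.monomial (b - mdeg m s) 1) else 0

/-- The sign with which the facet opposite to `j` occurs in the boundary of `s`. -/
def faceSign (K : Type*) [Field K] {r : ℕ} (s : Finset (Fin r)) (j : Fin r) : K :=
  (-1) ^ (s.filter (· < j)).card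

theorem faceSign_mul_self (K : Type*) [Field K] {r : ℕ} (s : Finset (Fin r)) (j : Fin r) :
    faceSign K s j * faceSign K s j = 1 := by
  unfold faceSign
  rw [← mul_pow]
  simp

theorem faceSign_insert (K : Type*) [Field K] {r : ℕ} {s : Finset (Fin r)} {j k : Fin r}
    (hk : k ∉ s) :
    faceSign K (insert k s) j = if k < j then -faceSign K s j else faceSign K s j := by
  unfold faceSign
  rw [Finset.filter_insert]
  split_ifs
  · rw [Finset.card_insert_of_notMem (by simp [hk]), pow_succ]
    ring
  · rfl

theorem faceSign_erase_self (K : Type*) [Field K] {r : ℕ} (s : Finset (Fin r)) (j : Fin r) :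
    faceSign K (s.erase j) j = faceSign K s j := by
  by_cases hj : j ∈ s
  · conv_rhs => rw [← Finset.insert_erase hj, faceSign_insert K (Finset.notMem_erase j s)]
    simp
  · rw [Finset.erase_eq_of_notMem hj]

theorem faceSign_erase (K : Type*) [Field K] {r : ℕ} {s : Finset (Fin r)} {j k : Fin r}
    (hk : k ∈ s) :
    faceSign K (s.erase k) j = if k < j then -faceSign K s j else faceSign K s j := by
  conv_rhs => rw [← Finset.insert_erase hk, faceSign_insert K (Finset.notMem_erase k s)]
  split_ifs <;> simp

theorem mdeg_mono {σ : Type*} {r : ℕ} (m : Fin r → (σ →₀ ℕ)) {s t : Finset (Fin r)}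
    (h : s ⊆ t) : mdeg m s ≤ mdeg m t :=
  Finset.sup_mono h

theorem scarfD_scarfElem {σ K : Type*} [Field K] {r : ℕ} (m : Fin r → (σ →₀ ℕ)) {i : ℕ}
    {b : σ →₀ ℕ} {s : Finset (Fin r)} (hs : IsScarfFace m s) (hc : s.card = i + 1)
    (hb : mdeg m s ≤ b) :
    scarfD K m i (scarfElem K m (i + 1) b s) =
      ∑ j ∈ s, faceSign K s j • scarfElem K m i b (s.erase j) := by
  rw [scarfElem, dif_pos ⟨hs, hc⟩, scarfD, Finsupp.linearCombination_single, Finset.smul_sum,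
    ← Finset.sum_coe_sort s, Finset.sum_congr rfl]
  rintro ⟨j, hj⟩ -
  have hc' : (s.erase j).card = i := by rw [Finset.card_erase_of_mem hj, hc]; rfl
  rw [scarfElem, dif_pos ⟨hs.erase hj, hc'⟩, Finsupp.smul_single, Finsupp.smul_single, smul_eq_mul,
    MvPolynomial.monomial_mul, MvPolynomial.smul_monomial,
    tsub_add_tsub_cancel hb (mdeg_mono m (Finset.erase_subset j s))]
  simp [ScarfFace.del, faceSign]

/-- The elements `x ^ (b - mdeg s) [s]` span the algebraic Scarf complex over `K`. -/
theorem scarfElem_induction {σ K : Type*} [Field K] {r : ℕ} {m : Fin r → (σ →₀ ℕ)} {i : ℕ}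
    {N : Type*} [AddCommGroup N] [Module K N]
    {f g : (ScarfFace m i →₀ MvPolynomial σ K) →ₗ[K] N}
    (h : ∀ b s, IsScarfFace m s → s.card = i → mdeg m s ≤ b →
      f (scarfElem K m i b s) = g (scarfElem K m i b s)) : f = g := by
  refine Finsupp.lhom_ext' fun s => (MvPolynomial.basisMonomials σ K).ext fun a => ?_
  rw [MvPolynomial.coe_basisMonomials]
  have := h (a + mdeg m s.1) s.1 s.2.1 s.2.2 le_add_self
  rw [scarfElem, dif_pos s.2, add_tsub_cancel_right] at this
  exact this

theorem scarfD_comp_scarfD {σ K : Type*} [Field K] {r : ℕ} (m : Fin r → (σ →₀ ℕ)) (i : ℕ)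
    (y : ScarfFace m (i + 2) →₀ MvPolynomial σ K) : scarfD K m i (scarfD K m (i + 1) y) = 0 := by
  have key : ((scarfD K m i).comp (scarfD K m (i + 1))).restrictScalars K = 0 := by
    refine scarfElem_induction fun b s hs hc hb => ?_
    rw [LinearMap.restrictScalars_apply, LinearMap.comp_apply, scarfD_scarfElem m hs hc hb, map_sum]
    have : ∀ j ∈ s, scarfD K m i (faceSign K s j • scarfElem K m (i + 1) b (s.erase j)) =
        ∑ k ∈ s.erase j, (faceSign K s j * faceSign K (s.erase j) k) •
          scarfElem K m i b ((s.erase j).erase k) := by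
      intro j hj
      rw [LinearMap.map_smul_of_tower, scarfD_scarfElem m (hs.erase hj)
        (by rw [Finset.card_erase_of_mem hj, hc]; rfl)
        ((mdeg_mono m (Finset.erase_subset j s)).trans hb), Finset.smul_sum]
      simp only [mul_smul]
    rw [Finset.sum_congr rfl this, Finset.sum_sigma']
    -- Deleting `j` then `k` cancels against `k` then `j`: exactly one of the two deletions flips
    -- the sign of the other vertex.
    refine Finset.sum_involution (fun p _ => ⟨p.2, p.1⟩) ?_ ?_ ?_ ?_
    · rintro ⟨j, k⟩ hp
      simp only [Finset.mem_sigma, Finset.mem_erase] at hp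
      obtain ⟨hj, hkj, hk⟩ := hp
      simp only
      rw [Finset.erase_right_comm, ← add_smul, faceSign_erase K hj, faceSign_erase K hk]
      rcases lt_or_gt_of_ne hkj with h | h
      · rw [if_neg h.not_gt, if_pos h]
        convert zero_smul K _
        ring
      · rw [if_neg h.not_gt, if_pos h]
        convert zero_smul K _
        ring
    · rintro ⟨j, k⟩ hp _ h
      simp only [Finset.mem_sigma, Finset.mem_erase] at hp
      simp only [Sigma.mk.injEq] at h
      exact hp.2.1 h.1
    · rintro ⟨j, k⟩ hp
      simp only [Finset.mem_sigma, Finset.mem_erase] at hp ⊢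
      exact ⟨hp.2.2, hp.2.1.symm, hp.1⟩
    · rintro ⟨j, k⟩ hp
      rfl
  exact LinearMap.congr_fun key y

/-! ### The contracting homotopy -/

/-- The `K`-linear cone operator of the algebraic Scarf complex with apex `v b` in degree `b`. -/
noncomputable def scarfCone {σ : Type*} (K : Type*) [Field K] {r : ℕ} (m : Fin r → (σ →₀ ℕ))
    (v : (σ →₀ ℕ) → Fin r) (i : ℕ) :
    (ScarfFace m i →₀ MvPolynomial σ K) →ₗ[K] (ScarfFace m (i + 1) →₀ MvPolynomial σ K) :=
  Finsupp.lsum K fun s => (MvPolynomial.basisMonomials σ K).constr K fun a =>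
    if v (a + mdeg m s.1) ∈ s.1 then 0 else
      faceSign K s.1 (v (a + mdeg m s.1)) •
        scarfElem K m (i + 1) (a + mdeg m s.1) (insert (v (a + mdeg m s.1)) s.1)

theorem scarfCone_scarfElem {σ K : Type*} [Field K] {r : ℕ} (m : Fin r → (σ →₀ ℕ))
    (v : (σ →₀ ℕ) → Fin r) {i : ℕ} {b : σ →₀ ℕ} {s : Finset (Fin r)} (hs : IsScarfFace m s)
    (hc : s.card = i) (hb : mdeg m s ≤ b) :
    scarfCone K m v i (scarfElem K m i b s) = if v b ∈ s then 0 else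
      faceSign K s (v b) • scarfElem K m (i + 1) b (insert (v b) s) := by
  rw [scarfElem, dif_pos ⟨hs, hc⟩, scarfCone, Finsupp.lsum_single,
    show MvPolynomial.monomial (b - mdeg m s) (1 : K) =
      MvPolynomial.basisMonomials σ K (b - mdeg m s) by rw [MvPolynomial.coe_basisMonomials],
    Module.Basis.constr_basis]
  simp only [tsub_add_cancel_of_le hb]

/-- The facet opposite to the apex returns `s`, its sign squaring to 1. For `s = ∅` no other facet
remains, which gives exactness at `F 0`. -/
theorem scarfD_scarfCone {σ K : Type*} [Field K] {r : ℕ} {m : Fin r → (σ →₀ ℕ)}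
    {v : (σ →₀ ℕ) → Fin r} {i : ℕ} {b : σ →₀ ℕ} {s : Finset (Fin r)} (hs : IsScarfFace m s)
    (hc : s.card = i) (hb : mdeg m s ≤ b) (hv : IsScarfApex m b (v b)) (hvs : v b ∉ s) :
    scarfD K m i (scarfCone K m v i (scarfElem K m i b s)) = scarfElem K m i b s +
      ∑ j ∈ s, (faceSign K s (v b) * faceSign K (insert (v b) s) j) •
        scarfElem K m i b ((insert (v b) s).erase j) := by
  rw [scarfCone_scarfElem m v hs hc hb, if_neg hvs, LinearMap.map_smul_of_tower,
    scarfD_scarfElem m (hv.2 s hs hb) (by rw [Finset.card_insert_of_notMem hvs, hc])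
      (by unfold mdeg at hb ⊢; rw [Finset.sup_insert]; exact sup_le hv.1 hb),
    Finset.sum_insert hvs, smul_add, Finset.smul_sum, Finset.erase_insert hvs, ← mul_smul,
    faceSign_insert K hvs, if_neg (lt_irrefl _), faceSign_mul_self, one_smul]
  simp only [mul_smul]

/-- In positive homological degree `s` has a vertex, so `b` is a degree of `M` and has an apex. The
homotopy is only `K`-linear because the apex varies with `b`. -/
theorem scarf_homotopy {σ K : Type*} [Field K] {r : ℕ} {m : Fin r → (σ →₀ ℕ)}
    {v : (σ →₀ ℕ) → Fin r} (hv : ∀ b, (∃ j, m j ≤ b) → IsScarfApex m b (v b)) (i : ℕ)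
    (y : ScarfFace m (i + 1) →₀ MvPolynomial σ K) :
    scarfD K m (i + 1) (scarfCone K m v (i + 1) y) + scarfCone K m v i (scarfD K m i y) = y := by
  have key : ((scarfD K m (i + 1)).restrictScalars K).comp (scarfCone K m v (i + 1)) +
      (scarfCone K m v i).comp ((scarfD K m i).restrictScalars K) = LinearMap.id := by
    refine scarfElem_induction fun b s hs hc hb => ?_
    obtain ⟨j₀, hj₀⟩ : s.Nonempty := Finset.card_pos.1 (by omega)
    have hvb := hv b ⟨j₀, (Finset.le_sup (f := m) hj₀).trans hb⟩
    have hcone : ∀ j ∈ s, scarfCone K m v i (faceSign K s j • scarfElem K m i b (s.erase j)) =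
        if v b ∈ s.erase j then 0 else (faceSign K s j * faceSign K (s.erase j) (v b)) •
          scarfElem K m (i + 1) b (insert (v b) (s.erase j)) := by
      intro j hj
      rw [map_smul, scarfCone_scarfElem m v (hs.erase hj)
        (by rw [Finset.card_erase_of_mem hj, hc]; rfl)
        ((mdeg_mono m (Finset.erase_subset j s)).trans hb), smul_ite, smul_zero, mul_smul]
    simp only [LinearMap.add_apply, LinearMap.comp_apply, LinearMap.restrictScalars_apply,
      LinearMap.id_apply]
    rw [scarfD_scarfElem m hs hc hb, map_sum, Finset.sum_congr rfl hcone]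
    -- If the apex lies in `s`, the cone over `s` vanishes and only the facet without the apex is
    -- coned, back to `s`. Otherwise the remaining terms cancel in pairs.
    by_cases hvs : v b ∈ s
    · rw [scarfCone_scarfElem m v hs hc hb, if_pos hvs, map_zero, zero_add,
        Finset.sum_eq_single_of_mem (v b) hvs, if_neg (Finset.notMem_erase _ _),
        Finset.insert_erase hvs, faceSign_erase_self, faceSign_mul_self, one_smul]
      intro j _ hjv
      rw [if_pos (Finset.mem_erase.2 ⟨hjv.symm, hvs⟩)]
    · rw [scarfD_scarfCone hs hc hb hvb hvs, add_assoc, ← Finset.sum_add_distrib,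
        Finset.sum_eq_zero, add_zero]
      intro j hj
      have hjv : j ≠ v b := fun h => hvs (h ▸ hj)
      rw [if_neg fun h => hvs (Finset.mem_of_mem_erase h),
        Finset.erase_insert_of_ne hjv.symm, ← add_smul, faceSign_insert K hvs, faceSign_erase K hj]
      convert zero_smul K _
      rcases lt_or_gt_of_ne hjv with h | h
      · rw [if_neg h.not_gt, if_pos h]
        ring
      · rw [if_neg h.not_gt, if_pos h]
        ring
  exact LinearMap.congr_fun key y

/-! ### Exactness and minimality -/

theorem mdeg_empty {σ : Type*} {r : ℕ} (m : Fin r → (σ →₀ ℕ)) : mdeg m ∅ = 0 := rfl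

theorem monomial_mem_span_X {σ K : Type*} [Field K] {a : σ →₀ ℕ} (ha : a ≠ 0) (c : K) :
    MvPolynomial.monomial a c ∈
      Ideal.span (Set.range (MvPolynomial.X : σ → MvPolynomial σ K)) := by
  rw [← Set.image_univ, MvPolynomial.mem_ideal_span_X_image]
  intro d hd
  have : d = a := by simpa using MvPolynomial.support_monomial_subset hd
  subst this
  obtain ⟨x, hx⟩ := Finsupp.ne_iff.1 ha
  exact ⟨x, trivial, hx⟩

/-- The Scarf complex resolves `S ⧸ M` when it is a cone in every degree of `M`. -/
theorem isMinimalFreeResolution_of_isScarfApex {σ K : Type*} [Field K]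
    {M : Ideal (MvPolynomial σ K)} {r : ℕ} {m : Fin r → (σ →₀ ℕ)}
    (hM : M = Ideal.span ((fun a => MvPolynomial.monomial a (1 : K)) '' Set.range m))
    {v : (σ →₀ ℕ) → Fin r} (hv : ∀ b, (∃ j, m j ≤ b) → IsScarfApex m b (v b)) :
    IsMinimalFreeResolution M (fun i => ScarfFace m i →₀ MvPolynomial σ K)
      (scarfD K m) (scarfAug M m) := by
  have hmem : ∀ j, MvPolynomial.monomial (m j) (1 : K) ∈ M := fun j => by
    rw [hM]; exact Ideal.subset_span ⟨m j, ⟨j, rfl⟩, rfl⟩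
  have hempty : ∀ s : ScarfFace m 0, s.1 = ∅ := fun s => Finset.card_eq_zero.1 s.2.2
  have hsub : Subsingleton (ScarfFace m 0) :=
    ⟨fun s t => Subtype.ext ((hempty s).trans (hempty t).symm)⟩
  have haug : ∀ s p, scarfAug (K := K) M m (Finsupp.single s p) = Ideal.Quotient.mk M p := by
    intro s p
    rw [scarfAug, Finsupp.linearCombination_single, ← Ideal.Quotient.mk_eq_mk,
      ← Submodule.mkQ_apply]
    conv_rhs => rw [← mul_one p, ← smul_eq_mul, map_smul]
    rfl
  refine ⟨fun i => inferInstance, fun i => inferInstance, ?_, ?_, ?_, ?_⟩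
  · intro i y
    constructor
    · intro hy
      refine ⟨scarfCone K m v (i + 1) y, ?_⟩
      have := scarf_homotopy hv i y
      rwa [hy, map_zero, add_zero] at this
    · rintro ⟨z, rfl⟩
      exact scarfD_comp_scarfD m i z
  · intro y
    constructor
    · intro hy
      have hrange : ∀ s : ScarfFace m 0, ∀ p ∈ M,
          Finsupp.single s p ∈ LinearMap.range (scarfD K m 0) := by
        intro s
        suffices h : M ≤ Submodule.comap (Finsupp.lsingle s) (LinearMap.range (scarfD K m 0)) from
          fun p hp => h hp
        conv_lhs => rw [hM]
        refine Ideal.span_le.2 ?_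
        rintro _ ⟨_, ⟨j, rfl⟩, rfl⟩
        -- The cone over `∅` in degree `m j` has boundary `x ^ (m j) [∅]`, whichever apex was
        -- chosen.
        refine ⟨scarfCone K m v 0 (scarfElem K m 0 (m j) s.1), ?_⟩
        rw [scarfD_scarfCone s.2.1 s.2.2 (by rw [hempty]; exact bot_le) (hv _ ⟨j, le_rfl⟩)
          (by simp [hempty]), hempty s, Finset.sum_empty, add_zero, scarfElem,
          dif_pos ⟨hempty s ▸ s.2.1, rfl⟩, mdeg_empty, tsub_zero, Finsupp.lsingle_apply]
        congr 1
        exact Subsingleton.elim _ _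
      rcases isEmpty_or_nonempty (ScarfFace m 0) with he | ⟨⟨s⟩⟩
      · exact ⟨0, Finsupp.ext fun s => he.elim s⟩
      · have hys : y = Finsupp.single s (y s) := by
          ext t : 1
          rw [Subsingleton.elim t s, Finsupp.single_eq_same]
        rw [hys, haug, Ideal.Quotient.eq_zero_iff_mem] at hy
        rw [hys]
        exact hrange s _ hy
    · rintro ⟨z, rfl⟩
      suffices h : (scarfAug M m).comp (scarfD K m 0) = 0 from LinearMap.congr_fun h z
      refine Finsupp.lhom_ext' fun s => LinearMap.ext_ring ?_
      simp only [LinearMap.comp_apply, Finsupp.lsingle_apply, LinearMap.zero_apply, scarfD,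
        Finsupp.linearCombination_single, one_smul, map_sum]
      refine Finset.sum_eq_zero fun j _ => ?_
      obtain ⟨i, hi⟩ := Finset.card_eq_one.1 s.2.2
      have hji : j.1 = i := by simpa [hi] using j.2
      rw [haug, Ideal.Quotient.eq_zero_iff_mem, hji, hi, Finset.erase_singleton, mdeg_empty,
        tsub_zero, mdeg, Finset.sup_singleton, ← mul_one ((-1 : K) ^ _), ← MvPolynomial.C_mul_monomial]
      exact Ideal.mul_mem_left _ _ (hmem i)
  · intro q
    obtain ⟨p, rfl⟩ := Ideal.Quotient.mk_surjective q
    by_cases hs : IsScarfFace m ∅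
    · exact ⟨Finsupp.single ⟨∅, hs, rfl⟩ p, haug _ p⟩
    -- Degenerate case: `∅` is not Scarf exactly when some generator is 1, and then `S ⧸ M = 0`.
    · unfold IsScarfFace at hs
      push Not at hs
      obtain ⟨t, ht, hne⟩ := hs
      obtain ⟨j, hj⟩ := hne
      have hz : m j = 0 := by
        have : m j ≤ mdeg m t := Finset.le_sup hj
        rw [ht, mdeg_empty] at this
        exact le_antisymm this (bot_le)
      have htop : M = ⊤ := by
        rw [Ideal.eq_top_iff_one]
        have := hmem j
        rwa [hz] at this
      refine ⟨0, ?_⟩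
      rw [map_zero, eq_comm, Ideal.Quotient.eq_zero_iff_mem, htop]
      trivial
  · intro i
    rw [scarfD, Finsupp.range_linearCombination, Submodule.span_le]
    rintro _ ⟨s, rfl⟩
    refine Submodule.sum_mem _ fun j _ => ?_
    rw [← mul_one (MvPolynomial.monomial _ _), ← smul_eq_mul, ← Finsupp.smul_single]
    refine Submodule.smul_mem_smul (monomial_mem_span_X ?_ _) trivial
    -- A constant coefficient would give a facet the same lcm as the Scarf face `s`.
    intro h
    have hle : mdeg m s.1 ≤ mdeg m (s.1.erase j.1) := tsub_eq_zero_iff_le.1 h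
    exact Finset.erase_ne_self.2 j.2 (s.2.1 _
      (le_antisymm (mdeg_mono m (Finset.erase_subset _ _)) hle))

/-! ### Dominant generators and regular sequences -/

/-- A monomial ideal all of whose minimal generators, with at most one exception, are dominant is
Scarf. -/
theorem isScarfIdeal_of_forall_isDominantIn {σ K : Type*} [Field K]
    {M : Ideal (MvPolynomial σ K)} (hM : IsMonomialIdeal M) {n : σ →₀ ℕ} (hn : n ∈ minGens M)
    (hdom : ∀ a ∈ minGens M, a ≠ n → IsDominantIn (minGens M) a) : IsScarfIdeal M := by
  intro r m hm hr
  rw [← hr] at hn hdom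
  obtain ⟨n, rfl⟩ := hn
  have hex : ∀ b, ∃ v, (∃ j, m j ≤ b) → IsScarfApex m b v := by
    intro b
    by_cases h : ∃ j, m j ≤ b
    · obtain ⟨j, hj⟩ := h
      obtain ⟨v, hv⟩ := exists_isScarfApex hm (fun i hi => hdom _ ⟨i, rfl⟩ (hm.ne hi)) hj
      exact ⟨v, fun _ => hv⟩
    -- Outside the degrees of `M` the apex is a dummy value.
    · exact ⟨n, fun h' => absurd h' h⟩
  choose v hv using hex
  refine isMinimalFreeResolution_of_isScarfApex ?_ hv
  rw [hr, hM.span_minGens]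

/-- Incomparable monomials that form a weakly regular sequence are pairwise coprime. -/
theorem pairwise_disjoint_of_isWeaklyRegular {σ K : Type*} [Field K] {L : List (σ →₀ ℕ)}
    (hanti : IsAntichain (· ≤ ·) {a | a ∈ L})
    (hreg : RingTheory.Sequence.IsWeaklyRegular (MvPolynomial σ K)
      (L.map fun a => MvPolynomial.monomial a (1 : K))) :
    L.Pairwise fun a b => a ⊓ b = 0 := by
  rw [List.pairwise_iff_getElem]
  intro i j hi hj hij
  by_contra hne
  have hr := hreg.regular_mod_prev j (by simpa using hj)
  have hmem : ∀ p : MvPolynomial σ K,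
      p ∈ (Ideal.ofList ((L.map fun a => MvPolynomial.monomial a (1 : K)).take j) •
        (⊤ : Submodule (MvPolynomial σ K) (MvPolynomial σ K))) ↔
      p ∈ Ideal.span ((fun a => MvPolynomial.monomial a (1 : K)) '' {a | a ∈ L.take j}) := by
    intro p
    rw [smul_eq_mul, Ideal.mul_top, ← List.map_take]
    have : {x | x ∈ (L.take j).map fun a => MvPolynomial.monomial a (1 : K)} =
        (fun a => MvPolynomial.monomial a (1 : K)) '' {a | a ∈ L.take j} := by
      ext; simp only [Set.mem_ofPred_eq, List.mem_map, Set.mem_image]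
    rw [Ideal.ofList, this]
  have hitake : L[i] ∈ L.take j := List.mem_take_iff_getElem.2 ⟨i, by omega, rfl⟩
  -- `L[j]` times `L[i] / gcd` is the lcm, a multiple of the earlier `L[i]`; regularity puts `L[i] /
  -- gcd` in the ideal of the earlier terms. Some earlier `a` then divides `L[i] / gcd`, and as the
  -- gcd is not 1, `a` is a proper divisor of `L[i]`, against incomparability.
  have hquot := (isSMulRegular_quotient_iff_mem_of_smul_mem _ _).1 hr
    (MvPolynomial.monomial (L[i] - L[i] ⊓ L[j]) 1) (by
      rw [List.getElem_map, hmem, smul_eq_mul, MvPolynomial.monomial_mul,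
        MvPolynomial.mem_ideal_span_monomial_image]
      intro d hd
      have hd' := Finset.mem_singleton.1 (MvPolynomial.support_monomial_subset hd)
      refine ⟨L[i], hitake, ?_⟩
      rw [hd']
      intro x
      simp only [Finsupp.add_apply, Finsupp.tsub_apply, Finsupp.inf_apply]
      omega)
  rw [hmem, MvPolynomial.mem_ideal_span_monomial_image] at hquot
  obtain ⟨a, ha, hle⟩ := hquot (L[i] - L[i] ⊓ L[j])
    (by classical
        rw [MvPolynomial.mem_support_iff, MvPolynomial.coeff_monomial, if_pos rfl]
        exact one_ne_zero)
  have hlt : ¬ L[i] ≤ a := by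
    intro h
    refine hne (Finsupp.ext fun x => ?_)
    have := h.trans hle x
    simp only [Finsupp.tsub_apply, Finsupp.inf_apply, Finsupp.zero_apply] at this ⊢
    omega
  exact hanti (List.mem_of_mem_take ha) (List.getElem_mem hi) (fun h => hlt h.ge)
    (hle.trans tsub_le_self)

theorem corollary5p9 {σ K : Type*} [Finite σ] [Field K] :
    (∀ M : Ideal (MvPolynomial σ K), IsSemidominantIdeal M → IsScarfIdeal M) ∧
    (∀ M : Ideal (MvPolynomial σ K), IsMonomialAlmostCI M → IsScarfIdeal M) := by
  constructor
  · rintro M ⟨hM, n, ⟨hn, -⟩, huniq⟩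
    refine isScarfIdeal_of_forall_isDominantIn hM hn fun a ha hne => ?_
    by_contra hdom
    exact hne (huniq a ⟨ha, hdom⟩)
  · rintro M ⟨hM, L, l, -, hG, hreg⟩
    have hanti : IsAntichain (· ≤ ·) (minGens M) := setOfPred_minimal_antichain _
    have hcop := pairwise_disjoint_of_isWeaklyRegular
      (hanti.subset (by rw [hG]; exact Set.subset_insert _ _)) hreg.toIsWeaklyRegular
    have hl : l ∈ minGens M := by simp [hG]
    refine isScarfIdeal_of_forall_isDominantIn hM hl fun a ha hne => ?_
    have haL : a ∈ L := by
      rw [hG] at ha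
      exact ha.resolve_left hne
    obtain ⟨x, hx⟩ : ∃ x, l x < a x := by
      by_contra! h
      exact hanti ha hl hne h
    -- The exponent of `l` at `x` is smaller by choice of `x`; every other generator is coprime to
    -- `a`, so its exponent there is 0.
    refine ⟨x, a x, by omega, le_rfl, fun b hb hba => ?_⟩
    rw [hG] at hb
    rcases hb with rfl | hb
    · omega
    · have : Std.Symm fun a b : σ →₀ ℕ => a ⊓ b = 0 := ⟨fun a b h => by rwa [inf_comm]⟩
      have h0 := hcop.forall hb haL hba
      have := DFunLike.congr_fun h0 x
      simp only [Finsupp.inf_apply, Finsupp.zero_apply] at this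
      omega
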